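/- Let $n,m,r\in\mathbb N$ and let $A,Q\in\mathbb R^{n\times n}$, $B,L\in\mathbb R^{n\times m}$, $R\in\mathbb R^{m\times m}$, $A_0^i\in\mathbb R^{n\times n}$, $B_0^i\in\mathbb R^{n\times m}$ ($i=1,\dots,r$). For $X\in\mathbb R^{n\times n}$ put $$\Pi_{11}(X)=\sum_{i=1}^r A_0^{i\top}XA_0^i,\quad \Pi_{12}(X)=\sum_{i=1}^r A_0^{i\top}XB_0^i,\quad \Pi_{22}(X)=\sum_{i=1}^r B_0^{i\top}XB_0^i,$$ $L_c(X)=L+\Pi_{12}(X)$, $R_c(X)=R+\Pi_{22}(X)$, $Q_c(X)=Q+\Pi_{11}(X)$, and $$A_c(X)=A-BR_c(X)^{-1}L_c(X)^\top,\quad G_c(X)=BR_c(X)^{-1}B^\top,\quad H_c(X)=Q_c(X)-L_c(X)R_c(X)^{-1}L_c(X)^\top,$$ $$\mathcal R(X)=A_c(X)^\top X+XA_c(X)-XG_c(X)X+H_c(X).$$ The stochastic continuous-time algebraic Riccati equation (SCARE) is $$A^\top X+XA+Q+\Pi_{11}(X)-(XB+L+\Pi_{12}(X))(R+\Pi_{22}(X))^{-1}(XB+L+\Pi_{12}(X))^\top=0.$$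 A real square matrix is called stable if all its eigenvalues have negative real part; $(A,B)$ is stabilizable if $A+BF$ is stable for some real matrix $F$, and $(C,A)$ is detectable if $(A^\top,C^\top)$ is stabilizable. For symmetric matrices, $X\le Y$ means that $Y-X$ is positive semidefinite (PSD). Assume that $R$ is symmetric positive definite, that $Q-LR^{-1}L^\top=C^\top C$ for a real matrix $C$ with $n$ columns, that $(A,B)$ is stabilizable and $(C,A)$ is detectable, and that $\operatorname{Ker}C\subseteq\bigl(\bigcap_{i=1}^r\operatorname{Ker}A_0^i\bigr)\cap\operatorname{Ker}L^\top$. Let $\widehat X\ge 0$ be a solution of the SCARE, and let $(X_k)_{k\ge 0}$ be a sequence generated by the FP-CARE\_SDA iteration with $X_0=0$; that is, with $A_k=A_c(X_k)$, $G_k=G_c(X_k)$, $H_k=H_c(X_k)$, for every $k\ge0$ the matrix $X_{k+1}$ is the stabilizing solution of $$A_k^\top X+XA_k-XG_kX+H_k=0,$$ i.e. the symmetric solution for which $A_k-G_kX_{k+1}$ is stable. Then: 1. for every $k\ge 0$: $X_k\le X_{k+1}$, $X_k\le\widehat X$, $\mathcal R(X_k)\ge 0$, and $A_k-G_k\widehat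 X$ is stable; 2. the limit $\widehat X_-=\lim_{k\to\infty}X_k$ exists, $0\le\widehat X_-\le\widehat X$, and $\widehat X_-$ is a solution of the SCARE; 3. every eigenvalue of $A_c(\widehat X_-)-G_c(\widehat X_-)\widehat X_-$ has real part $\le 0$. -/

import Mathlib

open Filter Topology Matrix

/-- A real square matrix is (Hurwitz) stable if all its complex eigenvalues have negative
real part. -/
def IsStableMatrix {n : ℕ} (M : Matrix (Fin n) (Fin n) ℝ) : Prop :=
  ∀ z ∈ spectrum ℂ (M.map (algebraMap ℝ ℂ)), z.re < 0

/-- The pair `(A, B)` is stabilizable: some state feedback makes `A + B F` stable. -/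
def IsStabilizablePair {n m : ℕ} (A : Matrix (Fin n) (Fin n) ℝ)
    (B : Matrix (Fin n) (Fin m) ℝ) : Prop :=
  ∃ F : Matrix (Fin m) (Fin n) ℝ, IsStableMatrix (A + B * F)

/-- The pair `(C, A)` is detectable: the dual pair `(Aᵀ, Cᵀ)` is stabilizable. -/
def IsDetectablePair {n p : ℕ} (C : Matrix (Fin p) (Fin n) ℝ)
    (A : Matrix (Fin n) (Fin n) ℝ) : Prop :=
  IsStabilizablePair Aᵀ Cᵀ

/-- The coefficient matrices of a stochastic continuous-time algebraic Riccati equation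
with `n` states, `m` inputs and `r` noise channels (`A0 i`, `B0 i` are the noise matrices). -/
structure SCAREData (n m r : ℕ) where
  A : Matrix (Fin n) (Fin n) ℝ
  B : Matrix (Fin n) (Fin m) ℝ
  Q : Matrix (Fin n) (Fin n) ℝ
  L : Matrix (Fin n) (Fin m) ℝ
  R : Matrix (Fin m) (Fin m) ℝ
  A0 : Fin r → Matrix (Fin n) (Fin n) ℝ
  B0 : Fin r → Matrix (Fin n) (Fin m) ℝ

namespace SCAREData

variable {n m r : ℕ} (D : SCAREData n m r) (X : Matrix (Fin n) (Fin n) ℝ)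

def Pi11 : Matrix (Fin n) (Fin n) ℝ := ∑ i, (D.A0 i)ᵀ * X * D.A0 i

def Pi12 : Matrix (Fin n) (Fin m) ℝ := ∑ i, (D.A0 i)ᵀ * X * D.B0 i

def Pi22 : Matrix (Fin m) (Fin m) ℝ := ∑ i, (D.B0 i)ᵀ * X * D.B0 i

def Lc : Matrix (Fin n) (Fin m) ℝ := D.L + D.Pi12 X

def Rc : Matrix (Fin m) (Fin m) ℝ := D.R + D.Pi22 X

def Qc : Matrix (Fin n) (Fin n) ℝ := D.Q + D.Pi11 X

noncomputable def Ac : Matrix (Fin n) (Fin n) ℝ := D.A - D.B * (D.Rc X)⁻¹ * (D.Lc X)ᵀ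

noncomputable def Gc : Matrix (Fin n) (Fin n) ℝ := D.B * (D.Rc X)⁻¹ * D.Bᵀ

noncomputable def Hc : Matrix (Fin n) (Fin n) ℝ := D.Qc X - D.Lc X * (D.Rc X)⁻¹ * (D.Lc X)ᵀ

/-- The Riccati operator `𝓡(X) = A_c(X)ᵀ X + X A_c(X) - X G_c(X) X + H_c(X)`. -/
noncomputable def riccati : Matrix (Fin n) (Fin n) ℝ :=
  (D.Ac X)ᵀ * X + X * D.Ac X - X * D.Gc X * X + D.Hc X

/-- `X` solves the SCARE
`Aᵀ X + X A + Q + Π₁₁(X) - (X B + L + Π₁₂(X)) (R + Π₂₂(X))⁻¹ (X B + L + Π₁₂(X))ᵀ = 0`. -/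
def IsSolution : Prop :=
  D.Aᵀ * X + X * D.A + D.Q + D.Pi11 X
    - (X * D.B + D.L + D.Pi12 X) * (D.R + D.Pi22 X)⁻¹ * (X * D.B + D.L + D.Pi12 X)ᵀ = 0

end SCAREData

/-- `X` is a (symmetric) stabilizing solution of the CARE `Aᵀ X + X A - X G X + H = 0`:
it solves the equation and the closed-loop matrix `A - G X` is stable. -/
structure IsStabilizingCARESolution {n : ℕ} (A G H X : Matrix (Fin n) (Fin n) ℝ) : Prop where
  symm : X.IsSymm
  eqn : Aᵀ * X + X * A - X * G * X + H = 0
  stable : IsStableMatrix (A - G * X)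

/-- `X₀, X₁, …` is generated by the fixed-point iteration: `X_{k+1}` is the stabilizing solution
of the CARE whose coefficients are `A_c`, `G_c`, `H_c` frozen at `X_k`. -/
def SCAREData.IsFPCARESequence {n m r : ℕ} (D : SCAREData n m r)
    (X : ℕ → Matrix (Fin n) (Fin n) ℝ) : Prop :=
  ∀ k, IsStabilizingCARESolution (D.Ac (X k)) (D.Gc (X k)) (D.Hc (X k)) (X (k + 1))

/-! Let F(X, Y) be the Riccati operator at X with coefficients frozen at Y, so that F(X_{k+1}, X_k)
= 0 along the iteration and the SCARE reads F(X, X) = 0. Two facts carry the proof.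

Monotonicity (`frozenRiccati_mono`): for Y ≥ 0, completing the square exhibits xᵀF(X, Y)x as the
minimum over inputs u of a cost in which Y enters only through a sum of values of its quadratic
form. Hence F(X, ·) is increasing.

Comparison (`frozenRiccati_sub`, `posSemidef_neg_of_lyapunov`): expanding F(·, Y) around X gives a
Lyapunov identity for X' - X with the closed-loop matrix at X. If that matrix is stable, the sign of
the right-hand side orders X and X'.

If 0 ≤ X_k ≤ X̂, then F(X̂, X_k) ≤ F(X̂, X̂) = 0, and detectability makes A_k - G_k X̂ stable
(`isStableMatrix_closedLoop`). Comparison around X_{k+1} and around X̂ gives X_k ≤ X_{k+1} ≤ X̂, and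
monotonicity gives F(X_{k+1}, X_{k+1}) ≥ F(X_{k+1}, X_k) = 0, closing the induction. The bounded
monotone sequence converges, and the equation and the closed half-plane condition pass to the limit.
-/

/-! ### Spectra of real matrices, powers and limits -/

namespace Matrix

variable {n : ℕ}

/-- A number belongs to the spectrum of a square matrix over a field iff it has an eigenvector. -/
theorem mem_spectrum_iff_exists_mulVec {ι K : Type*} [Fintype ι] [DecidableEq ι] [Field K]
    (M : Matrix ι ι K) (z : K) : z ∈ spectrum K M ↔ ∃ v ≠ 0, M *ᵥ v = z • v := by
  rw [spectrum.mem_iff, Matrix.isUnit_iff_isUnit_det, isUnit_iff_ne_zero, not_not,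
    ← Matrix.exists_mulVec_eq_zero_iff]
  refine exists_congr fun v => and_congr_right fun _ => ?_
  rw [Matrix.sub_mulVec, sub_eq_zero, Algebra.algebraMap_eq_smul_one, Matrix.smul_mulVec,
    Matrix.one_mulVec, eq_comm]

/-- The eigenvalue equation of a real matrix at a complex number, in real and imaginary parts. -/
theorem map_mulVec_eq_smul_iff (M : Matrix (Fin n) (Fin n) ℝ) (z : ℂ) (v : Fin n → ℂ) :
    M.map (algebraMap ℝ ℂ) *ᵥ v = z • v ↔
      M *ᵥ (fun i => (v i).re) = z.re • (fun i => (v i).re) - z.im • (fun i => (v i).im) ∧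
      M *ᵥ (fun i => (v i).im) = z.im • (fun i => (v i).re) + z.re • (fun i => (v i).im) := by
  simp only [funext_iff, ← forall_and]
  refine forall_congr' fun i => ?_
  rw [Complex.ext_iff]
  simp [mulVec, dotProduct, add_comm]

/-- A complex number is an eigenvalue of a real matrix iff there is a nonzero pair of real vectors
forming the real and imaginary part of an eigenvector. -/
theorem mem_spectrum_map_iff (M : Matrix (Fin n) (Fin n) ℝ) (z : ℂ) :
    z ∈ spectrum ℂ (M.map (algebraMap ℝ ℂ)) ↔ ∃ a b : Fin n → ℝ, (a ≠ 0 ∨ b ≠ 0) ∧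
      M *ᵥ a = z.re • a - z.im • b ∧ M *ᵥ b = z.im • a + z.re • b := by
  rw [mem_spectrum_iff_exists_mulVec]
  constructor
  · rintro ⟨v, hv, h⟩
    refine ⟨_, _, ?_, (map_mulVec_eq_smul_iff M z v).1 h⟩
    contrapose! hv
    ext i
    exact Complex.ext (congrFun hv.1 i) (congrFun hv.2 i)
  · rintro ⟨a, b, hab, h⟩
    refine ⟨fun i => ⟨a i, b i⟩, ?_, (map_mulVec_eq_smul_iff M z _).2 h⟩
    contrapose! hab
    constructor <;> ext i
    · exact congrArg Complex.re (congrFun hab i)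
    · exact congrArg Complex.im (congrFun hab i)

open scoped Matrix.Norms.Operator in
/-- If every eigenvalue of a complex matrix lies in the open unit disc, its powers tend to `0`. -/
theorem tendsto_pow_of_spectrum_subset_ball (N : Matrix (Fin n) (Fin n) ℂ)
    (hN : ∀ z ∈ spectrum ℂ N, ‖z‖ < 1) : Tendsto (fun k : ℕ => N ^ k) atTop (𝓝 0) := by
  rcases n.eq_zero_or_pos with rfl | hn
  · exact tendsto_const_nhds.congr fun k => Subsingleton.elim _ _
  have : Nonempty (Fin n) := ⟨⟨0, hn⟩⟩
  have h1 : spectralRadius ℂ N < (1 : NNReal) :=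
    spectrum.spectralRadius_lt_of_forall_lt N fun z hz => by exact_mod_cast hN z hz
  -- By Gelfand's formula, any q strictly between the spectral radius and 1 eventually dominates the
  -- k-th root of ‖N ^ k‖.
  obtain ⟨q, hq1, hq2⟩ := exists_between h1
  have h2 := spectrum.pow_nnnorm_pow_one_div_tendsto_nhds_spectralRadius N
  have h3 : ∀ᶠ k : ℕ in atTop, (‖N ^ k‖₊ : ENNReal) ≤ q ^ k := by
    filter_upwards [h2.eventually (gt_mem_nhds hq1), eventually_gt_atTop 0] with k hk hk0
    have := ENNReal.rpow_le_rpow hk.le (Nat.cast_nonneg (α := ℝ) k)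
    rwa [← ENNReal.rpow_mul, one_div, inv_mul_cancel₀ (by positivity), ENNReal.rpow_one,
      ENNReal.rpow_natCast] at this
  refine tendsto_zero_iff_norm_tendsto_zero.2 ?_
  have h4 : Tendsto (fun k : ℕ => (‖N ^ k‖₊ : ENNReal)) atTop (𝓝 0) :=
    tendsto_of_tendsto_of_tendsto_of_le_of_le' tendsto_const_nhds
      (ENNReal.tendsto_pow_atTop_nhds_zero_of_lt_one (by exact_mod_cast hq2))
      (Eventually.of_forall fun _ => zero_le) h3
  have h5 := NNReal.tendsto_coe.2
    (ENNReal.tendsto_coe.1 (h4 : Tendsto _ _ (𝓝 ((0 : NNReal) : ENNReal))))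
  simpa only [coe_nnnorm, NNReal.coe_zero] using h5

theorem tendsto_pow_of_map (N : Matrix (Fin n) (Fin n) ℝ)
    (hN : ∀ z ∈ spectrum ℂ (N.map (algebraMap ℝ ℂ)), ‖z‖ < 1) :
    Tendsto (fun k : ℕ => N ^ k) atTop (𝓝 0) := by
  have h := tendsto_pow_of_spectrum_subset_ball _ hN
  have hre : Continuous fun M : Matrix (Fin n) (Fin n) ℂ => M.map Complex.re :=
    continuous_id.matrix_map Complex.continuous_re
  have h2 := (hre.tendsto 0).comp h
  have h0 : (0 : Matrix (Fin n) (Fin n) ℂ).map Complex.re = 0 := by ext; simp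
  rw [h0] at h2
  refine h2.congr fun k => ?_
  have : N.map (algebraMap ℝ ℂ) ^ k = (N ^ k).map (algebraMap ℝ ℂ) :=
    (map_pow (algebraMap ℝ ℂ).mapMatrix N k).symm
  ext i j
  simp only [Function.comp_apply, this, Matrix.map_apply]
  exact Complex.ofReal_re _

/-- The determinant of `z - M` is bounded below by `(re z) ^ n` when `M` has spectrum in the
left half-plane. -/
theorem pow_re_le_norm_eval_charpoly (M : Matrix (Fin n) (Fin n) ℂ)
    (hM : ∀ w ∈ spectrum ℂ M, w.re ≤ 0) {z : ℂ} (hz : 0 < z.re) :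
    z.re ^ n ≤ ‖M.charpoly.eval z‖ := by
  have hs := IsAlgClosed.splits M.charpoly
  rw [hs.eval_eq_prod_roots_of_monic M.charpoly_monic]
  have hcard : M.charpoly.roots.card = n := by
    rw [← hs.natDegree_eq_card_roots, M.charpoly_natDegree_eq_dim, Fintype.card_fin]
  have key : ∀ s : Multiset ℂ, (∀ w ∈ s, w.re ≤ 0) →
      z.re ^ s.card ≤ ‖(s.map fun w => z - w).prod‖ := by
    intro s
    induction s using Multiset.induction with
    | empty => simp
    | cons w s ih =>
      intro h
      rw [Multiset.card_cons, Multiset.map_cons, Multiset.prod_cons, norm_mul, pow_succ']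
      refine mul_le_mul ?_ (ih fun w hw => h w (Multiset.mem_cons_of_mem hw)) (by positivity)
        (norm_nonneg _)
      have h1 := h w (Multiset.mem_cons_self w s)
      have h2 := Complex.re_le_norm (z - w)
      rw [Complex.sub_re] at h2
      linarith
  have := key M.charpoly.roots fun w hw =>
    hM w (Matrix.mem_spectrum_of_isRoot_charpoly (Polynomial.isRoot_of_mem_roots hw))
  rwa [hcard] at this

/-- A limit of complex matrices with spectrum in the closed left half-plane has its spectrum in
the closed left half-plane. -/
theorem re_nonpos_of_mem_spectrum_of_tendsto {M : ℕ → Matrix (Fin n) (Fin n) ℂ}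
    {M' : Matrix (Fin n) (Fin n) ℂ} (h : Tendsto M atTop (𝓝 M'))
    (hM : ∀ k, ∀ w ∈ spectrum ℂ (M k), w.re ≤ 0) {z : ℂ} (hz : z ∈ spectrum ℂ M') :
    z.re ≤ 0 := by
  by_contra! hpos
  have hcont : Continuous fun N : Matrix (Fin n) (Fin n) ℂ => ‖N.charpoly.eval z‖ := by
    simp only [Matrix.eval_charpoly]
    exact (continuous_const.sub continuous_id).matrix_det.norm
  have hle := ge_of_tendsto' ((hcont.tendsto M').comp h)
    fun k => pow_re_le_norm_eval_charpoly (M k) (hM k) hpos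
  rw [(Matrix.mem_spectrum_iff_isRoot_charpoly.1 hz : M'.charpoly.eval z = 0), norm_zero] at hle
  exact absurd hle (not_le.2 (pow_pos hpos n))

/-- For a symmetric matrix, the bilinear form is symmetric. -/
theorem IsSymm.mulVec_dotProduct_comm {ι : Type*} [Fintype ι] {P : Matrix ι ι ℝ} (hP : P.IsSymm)
    (x y : ι → ℝ) : x ⬝ᵥ P *ᵥ y = y ⬝ᵥ P *ᵥ x := by
  rw [dotProduct_mulVec, ← mulVec_transpose, hP.eq, dotProduct_comm]

theorem posSemidef_iff_real {ι : Type*} [Fintype ι] {P : Matrix ι ι ℝ} :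
    P.PosSemidef ↔ P.IsSymm ∧ ∀ x, 0 ≤ x ⬝ᵥ P *ᵥ x := by
  rw [posSemidef_iff_dotProduct_mulVec]
  simp [IsHermitian, IsSymm, conjTranspose_eq_transpose_of_trivial]

end Matrix

/-! ### Cayley transform and Lyapunov's inequality -/

section Stability

variable {n : ℕ} {M : Matrix (Fin n) (Fin n) ℝ}

theorem IsStableMatrix.isUnit_one_sub (hM : IsStableMatrix M) : IsUnit (1 - M) := by
  rw [Matrix.isUnit_iff_isUnit_det, isUnit_iff_ne_zero]
  intro h0
  obtain ⟨v, hv, h⟩ := Matrix.exists_mulVec_eq_zero_iff.2 h0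
  rw [Matrix.sub_mulVec, Matrix.one_mulVec, sub_eq_zero] at h
  have := hM 1 ((Matrix.mem_spectrum_map_iff M 1).2 ⟨v, 0, Or.inl hv, by simp [← h], by simp⟩)
  norm_num at this

/-- The powers of the Cayley transform of a stable matrix tend to `0`. -/
theorem IsStableMatrix.tendsto_cayley_pow (hM : IsStableMatrix M) :
    Tendsto (fun k : ℕ => ((1 + M) * (1 - M)⁻¹) ^ k) atTop (𝓝 0) := by
  have hu := (Matrix.isUnit_iff_isUnit_det _).1 hM.isUnit_one_sub
  refine Matrix.tendsto_pow_of_map _ fun z hz => ?_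
  obtain ⟨v, hv, h⟩ := (Matrix.mem_spectrum_iff_exists_mulVec _ _).1 hz
  set φ := (algebraMap ℝ ℂ).mapMatrix (m := Fin n)
  set w := φ (1 - M)⁻¹ *ᵥ v
  have hvw : v = φ (1 - M) *ᵥ w := by
    rw [Matrix.mulVec_mulVec, ← map_mul, Matrix.mul_nonsing_inv _ hu, map_one, Matrix.one_mulVec]
  have hw : w ≠ 0 := by
    intro h0
    rw [h0, Matrix.mulVec_zero] at hvw
    exact hv hvw
  have h1 : φ (1 + M) *ᵥ w = z • φ (1 - M) *ᵥ w := by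
    rw [← hvw, Matrix.mulVec_mulVec, ← map_mul]
    exact h
  rw [map_add, map_sub, map_one, Matrix.add_mulVec, Matrix.sub_mulVec, Matrix.one_mulVec] at h1
  have h2 : (z + 1) • φ M *ᵥ w = (z - 1) • w := by
    ext i
    have h1i := congrFun h1 i
    simp only [Pi.add_apply, Pi.sub_apply, Pi.smul_apply, smul_eq_mul] at h1i ⊢
    linear_combination h1i
  have hz1 : z + 1 ≠ 0 := by
    intro h0
    have hz' : z = -1 := by linear_combination h0
    rw [h0, zero_smul, hz'] at h2
    norm_num at h2
    exact hw h2
  -- Inverse Cayley map on eigenvalues: (z - 1) / (z + 1) has negative real part exactly when ‖z‖ <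
  -- 1.
  have h3 : φ M *ᵥ w = ((z - 1) / (z + 1)) • w := by
    rw [div_eq_inv_mul, mul_smul, ← h2, smul_smul, inv_mul_cancel₀ hz1, one_smul]
  have h4 := hM _ ((Matrix.mem_spectrum_iff_exists_mulVec _ _).2 ⟨w, hw, h3⟩)
  have h5 : 0 < Complex.normSq (z + 1) := Complex.normSq_pos.2 hz1
  rw [Complex.div_re, ← add_div, div_lt_iff₀ h5, zero_mul] at h4
  rw [← sq_lt_one_iff₀ (norm_nonneg z), Complex.sq_norm, Complex.normSq_apply]
  simp at h4
  nlinarith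

/-- **Lyapunov's inequality**: if `M` is stable and `Mᵀ Δ + Δ M` is positive semidefinite, then
`-Δ` is positive semidefinite. -/
theorem IsStableMatrix.posSemidef_neg_of_lyapunov (hM : IsStableMatrix M)
    {Δ : Matrix (Fin n) (Fin n) ℝ} (hΔ : Δ.IsSymm) (h : (Mᵀ * Δ + Δ * M).PosSemidef) :
    (-Δ).PosSemidef := by
  have hu := (Matrix.isUnit_iff_isUnit_det _).1 hM.isUnit_one_sub
  set N := (1 + M) * (1 - M)⁻¹ with hN
  -- With x = (1 - M) y, the two sides differ by 2 yᵀ(MᵀΔ + ΔM) y. Iterating, N ^ k → 0 forces xᵀΔx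
  -- ≤ 0.
  have hstep : ∀ x : Fin n → ℝ, x ⬝ᵥ Δ *ᵥ x ≤ (N *ᵥ x) ⬝ᵥ Δ *ᵥ (N *ᵥ x) := by
    intro x
    obtain ⟨y, rfl⟩ : ∃ y, x = (1 - M) *ᵥ y :=
      ⟨(1 - M)⁻¹ *ᵥ x, by rw [Matrix.mulVec_mulVec, Matrix.mul_nonsing_inv _ hu, Matrix.one_mulVec]⟩
    have e : N *ᵥ ((1 - M) *ᵥ y) = (1 + M) *ᵥ y := by
      rw [Matrix.mulVec_mulVec, hN, Matrix.mul_assoc, Matrix.nonsing_inv_mul _ hu, Matrix.mul_one]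
    have hy := (Matrix.posSemidef_iff_real.1 h).2 y
    rw [Matrix.add_mulVec, dotProduct_add, ← Matrix.mulVec_mulVec, ← Matrix.mulVec_mulVec,
      dotProduct_mulVec y Mᵀ, Matrix.vecMul_transpose] at hy
    have hs := hΔ.mulVec_dotProduct_comm y (M *ᵥ y)
    rw [e]
    simp only [Matrix.add_mulVec, Matrix.sub_mulVec, Matrix.one_mulVec, Matrix.mulVec_add,
      Matrix.mulVec_sub, dotProduct_add, add_dotProduct, dotProduct_sub, sub_dotProduct]
    linarith
  refine Matrix.posSemidef_iff_real.2 ⟨by simp [Matrix.IsSymm, hΔ.eq], fun x => ?_⟩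
  have hpow : ∀ k : ℕ, x ⬝ᵥ Δ *ᵥ x ≤ (N ^ k *ᵥ x) ⬝ᵥ Δ *ᵥ (N ^ k *ᵥ x) := by
    intro k
    induction k with
    | zero => simp
    | succ k ih =>
      refine ih.trans ((hstep _).trans_eq ?_)
      rw [Matrix.mulVec_mulVec, ← pow_succ']
  have hcont : Continuous fun P : Matrix (Fin n) (Fin n) ℝ => (P *ᵥ x) ⬝ᵥ Δ *ᵥ (P *ᵥ x) := by
    have : Continuous fun P : Matrix (Fin n) (Fin n) ℝ => P *ᵥ x :=
      continuous_id.matrix_mulVec continuous_const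
    exact this.dotProduct (continuous_const.matrix_mulVec this)
  have hle := ge_of_tendsto' ((hcont.tendsto 0).comp hM.tendsto_cayley_pow) hpow
  rw [Matrix.neg_mulVec, dotProduct_neg]
  simpa using hle

end Stability

/-! ### The frozen Riccati operator and its cost functional -/

namespace SCAREData

variable {n m r : ℕ} (D : SCAREData n m r) (X Y : Matrix (Fin n) (Fin n) ℝ)

/-- The Riccati operator at `X` with the coefficients `A_c`, `G_c`, `H_c` frozen at `Y`. -/
noncomputable def frozenRiccati : Matrix (Fin n) (Fin n) ℝ :=
  (D.Ac Y)ᵀ * X + X * D.Ac Y - X * D.Gc Y * X + D.Hc Y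

/-- The quadratic cost functional whose minimum over `u` is the quadratic form of
`frozenRiccati`. -/
def cost (x : Fin n → ℝ) (u : Fin m → ℝ) : ℝ :=
  2 * ((X *ᵥ x) ⬝ᵥ (D.A *ᵥ x + D.B *ᵥ u)) + x ⬝ᵥ D.Qc Y *ᵥ x + 2 * (x ⬝ᵥ D.Lc Y *ᵥ u)
    + u ⬝ᵥ D.Rc Y *ᵥ u

/-- The feedback gain with coefficients frozen at `Y`. -/
noncomputable def gain : Matrix (Fin m) (Fin n) ℝ := (D.Rc Y)⁻¹ * (X * D.B + D.Lc Y)ᵀ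

variable {D X Y}

theorem isSymm_Pi11 (hY : Y.IsSymm) : (D.Pi11 Y).IsSymm := by
  simp [Matrix.IsSymm, Pi11, Matrix.transpose_sum, Matrix.transpose_mul, Matrix.mul_assoc, hY.eq]

theorem isSymm_Qc (hQ : D.Q.IsSymm) (hY : Y.IsSymm) : (D.Qc Y).IsSymm :=
  hQ.add (isSymm_Pi11 hY)

theorem posDef_Rc (hR : D.R.PosDef) (hY : Y.PosSemidef) : (D.Rc Y).PosDef := by
  refine hR.add_posSemidef ?_
  refine Matrix.posSemidef_sum _ fun i _ => ?_
  simpa [conjTranspose_eq_transpose_of_trivial] using hY.conjTranspose_mul_mul_same (D.B0 i)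

theorem isSymm_inv_Rc (hRc : (D.Rc Y).IsSymm) : ((D.Rc Y)⁻¹).IsSymm := by
  rw [Matrix.IsSymm, Matrix.transpose_nonsing_inv, hRc.eq]

theorem isSymm_of_posDef {k : ℕ} {P : Matrix (Fin k) (Fin k) ℝ} (hP : P.PosDef) : P.IsSymm := by
  exact (conjTranspose_eq_transpose_of_trivial P).symm.trans hP.isHermitian

theorem frozenRiccati_eq (hX : X.IsSymm) (hRc : (D.Rc Y).IsSymm) :
    D.frozenRiccati X Y = D.Aᵀ * X + X * D.A + D.Qc Y
      - (X * D.B + D.Lc Y) * (D.Rc Y)⁻¹ * (X * D.B + D.Lc Y)ᵀ := by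
  have h := (isSymm_inv_Rc hRc).eq
  simp only [frozenRiccati, Ac, Gc, Hc, Matrix.transpose_sub, Matrix.transpose_add,
    Matrix.transpose_mul, Matrix.transpose_transpose, h, hX.eq, Matrix.mul_add, Matrix.add_mul,
    Matrix.mul_sub, Matrix.sub_mul, Matrix.mul_assoc]
  abel

theorem isSolution_iff (hX : X.IsSymm) (hRc : (D.Rc X).IsSymm) :
    D.IsSolution X ↔ D.frozenRiccati X X = 0 := by
  rw [frozenRiccati_eq hX hRc]
  simp only [IsSolution, Qc, Lc, Rc, add_assoc]

theorem isSymm_frozenRiccati (hQ : D.Q.IsSymm) (hX : X.IsSymm) (hY : Y.IsSymm)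
    (hRc : (D.Rc Y).IsSymm) : (D.frozenRiccati X Y).IsSymm := by
  rw [frozenRiccati_eq hX hRc, Matrix.IsSymm]
  have h := (isSymm_inv_Rc hRc).eq
  simp only [Matrix.transpose_sub, Matrix.transpose_add, Matrix.transpose_mul,
    Matrix.transpose_transpose, h, hX.eq, (isSymm_Qc hQ hY).eq, Matrix.mul_assoc]
  abel

/-- The closed-loop matrix is `A - B K` for the frozen gain `K`. -/
theorem Ac_sub_Gc_mul (hX : X.IsSymm) :
    D.Ac Y - D.Gc Y * X = D.A - D.B * D.gain X Y := by
  simp only [Ac, Gc, gain, Matrix.transpose_add, Matrix.transpose_mul, hX.eq, Matrix.mul_add,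
    Matrix.mul_assoc]
  abel

/-- Completing the square. -/
theorem cost_eq (hX : X.IsSymm) (hRc : (D.Rc Y).PosDef) (x : Fin n → ℝ) (u : Fin m → ℝ) :
    D.cost X Y x u = x ⬝ᵥ D.frozenRiccati X Y *ᵥ x
      + (u + D.gain X Y *ᵥ x) ⬝ᵥ D.Rc Y *ᵥ (u + D.gain X Y *ᵥ x) := by
  have hs := isSymm_of_posDef hRc
  have hu : IsUnit (D.Rc Y).det := (Matrix.isUnit_iff_isUnit_det _).1 hRc.isUnit
  set w := D.gain X Y *ᵥ x with hw
  have hRw : D.Rc Y *ᵥ w = (X * D.B + D.Lc Y)ᵀ *ᵥ x := by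
    rw [hw, gain, Matrix.mulVec_mulVec, ← Matrix.mul_assoc, Matrix.mul_nonsing_inv _ hu,
      Matrix.one_mul]
  have h1 : ∀ y, y ⬝ᵥ D.Rc Y *ᵥ w = (X *ᵥ x) ⬝ᵥ D.B *ᵥ y + x ⬝ᵥ D.Lc Y *ᵥ y := by
    intro y
    rw [hRw, dotProduct_mulVec, Matrix.vecMul_transpose, dotProduct_comm, Matrix.add_mulVec,
      dotProduct_add, ← Matrix.mulVec_mulVec, hX.mulVec_dotProduct_comm, dotProduct_comm]
  have h2 : x ⬝ᵥ D.frozenRiccati X Y *ᵥ x =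
      2 * ((X *ᵥ x) ⬝ᵥ D.A *ᵥ x) + x ⬝ᵥ D.Qc Y *ᵥ x - w ⬝ᵥ D.Rc Y *ᵥ w := by
    rw [h1, frozenRiccati_eq hX hs, Matrix.mul_assoc]
    change x ⬝ᵥ (_ - _ * D.gain X Y) *ᵥ x = _
    rw [Matrix.sub_mulVec, Matrix.add_mulVec, Matrix.add_mulVec, ← Matrix.mulVec_mulVec,
      ← Matrix.mulVec_mulVec, ← Matrix.mulVec_mulVec, ← hw, dotProduct_sub, dotProduct_add,
      dotProduct_add, dotProduct_mulVec x D.Aᵀ, Matrix.vecMul_transpose, Matrix.add_mulVec,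
      dotProduct_add, ← Matrix.mulVec_mulVec, hX.mulVec_dotProduct_comm x,
      hX.mulVec_dotProduct_comm x, dotProduct_comm (D.A *ᵥ x), dotProduct_comm (D.B *ᵥ w)]
    ring
  have h3 := hs.mulVec_dotProduct_comm w u
  have h4 := h1 u
  rw [h2, cost]
  simp only [Matrix.mulVec_add, dotProduct_add, add_dotProduct]
  linarith

/-- The dependence of the cost on the frozen matrix. -/
theorem cost_eq_add_sum (hY : Y.IsSymm) (x : Fin n → ℝ) (u : Fin m → ℝ) :
    D.cost X Y x u = 2 * ((X *ᵥ x) ⬝ᵥ (D.A *ᵥ x + D.B *ᵥ u)) + x ⬝ᵥ D.Q *ᵥ x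
      + 2 * (x ⬝ᵥ D.L *ᵥ u) + u ⬝ᵥ D.R *ᵥ u
      + ∑ i, (D.A0 i *ᵥ x + D.B0 i *ᵥ u) ⬝ᵥ Y *ᵥ (D.A0 i *ᵥ x + D.B0 i *ᵥ u) := by
  have e : ∀ {k l : ℕ} (S : Matrix (Fin n) (Fin k) ℝ) (T : Matrix (Fin n) (Fin l) ℝ) y z,
      y ⬝ᵥ (Sᵀ * Y * T) *ᵥ z = (S *ᵥ y) ⬝ᵥ Y *ᵥ (T *ᵥ z) := by
    intro k l S T y z
    rw [Matrix.mul_assoc, ← Matrix.mulVec_mulVec, dotProduct_mulVec, Matrix.vecMul_transpose,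
      ← Matrix.mulVec_mulVec]
  have hi : ∀ i, (D.A0 i *ᵥ x + D.B0 i *ᵥ u) ⬝ᵥ Y *ᵥ (D.A0 i *ᵥ x + D.B0 i *ᵥ u) =
      x ⬝ᵥ ((D.A0 i)ᵀ * Y * D.A0 i) *ᵥ x + 2 * (x ⬝ᵥ ((D.A0 i)ᵀ * Y * D.B0 i) *ᵥ u)
        + u ⬝ᵥ ((D.B0 i)ᵀ * Y * D.B0 i) *ᵥ u := by
    intro i
    have := hY.mulVec_dotProduct_comm (D.A0 i *ᵥ x) (D.B0 i *ᵥ u)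
    simp only [e, Matrix.mulVec_add, dotProduct_add, add_dotProduct]
    linarith
  simp only [hi, Finset.sum_add_distrib, ← Finset.mul_sum, ← dotProduct_sum, ← Matrix.sum_mulVec]
  simp only [cost, Qc, Lc, Rc, Pi11, Pi12, Pi22, Matrix.add_mulVec, dotProduct_add]
  ring

theorem dotProduct_frozenRiccati_le_cost (hX : X.IsSymm) (hRc : (D.Rc Y).PosDef)
    (x : Fin n → ℝ) (u : Fin m → ℝ) : x ⬝ᵥ D.frozenRiccati X Y *ᵥ x ≤ D.cost X Y x u := by
  rw [cost_eq hX hRc]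
  exact le_add_of_nonneg_right ((Matrix.posSemidef_iff_real.1 hRc.posSemidef).2 _)

theorem cost_gain (hX : X.IsSymm) (hRc : (D.Rc Y).PosDef) (x : Fin n → ℝ) :
    D.cost X Y x (-(D.gain X Y *ᵥ x)) = x ⬝ᵥ D.frozenRiccati X Y *ᵥ x := by
  simp [cost_eq hX hRc]

/-- The frozen Riccati operator is monotone in the frozen matrix. -/
theorem frozenRiccati_mono (hR : D.R.PosDef) (hQ : D.Q.IsSymm) (hX : X.IsSymm)
    {Z : Matrix (Fin n) (Fin n) ℝ} (hY : Y.PosSemidef) (hZ : Z.PosSemidef)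
    (hYZ : (Z - Y).PosSemidef) :
    (D.frozenRiccati X Z - D.frozenRiccati X Y).PosSemidef := by
  have hY' := (Matrix.posSemidef_iff_real.1 hY).1
  have hZ' := (Matrix.posSemidef_iff_real.1 hZ).1
  refine Matrix.posSemidef_iff_real.2 ⟨(isSymm_frozenRiccati hQ hX hZ'
    (isSymm_of_posDef (posDef_Rc hR hZ))).sub (isSymm_frozenRiccati hQ hX hY'
    (isSymm_of_posDef (posDef_Rc hR hY))), fun x => ?_⟩
  rw [Matrix.sub_mulVec, dotProduct_sub, sub_nonneg, ← cost_gain hX (posDef_Rc hR hZ)]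
  -- The input optimal for Z serves as a trial input for Y.
  refine (dotProduct_frozenRiccati_le_cost hX (posDef_Rc hR hY) x
    (-(D.gain X Z *ᵥ x))).trans ?_
  rw [cost_eq_add_sum hY', cost_eq_add_sum hZ']
  gcongr with i
  have := (Matrix.posSemidef_iff_real.1 hYZ).2 (D.A0 i *ᵥ x + D.B0 i *ᵥ -(D.gain X Z *ᵥ x))
  rwa [Matrix.sub_mulVec, dotProduct_sub, sub_nonneg] at this

/-- The frozen Riccati operator expanded around a point. -/
theorem frozenRiccati_sub {X' : Matrix (Fin n) (Fin n) ℝ} (hX : X.IsSymm)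
    (hRc : (D.Rc Y).IsSymm) :
    (D.Ac Y - D.Gc Y * X)ᵀ * (X' - X) + (X' - X) * (D.Ac Y - D.Gc Y * X) =
      D.frozenRiccati X' Y - D.frozenRiccati X Y + (X' - X) * D.Gc Y * (X' - X) := by
  have hG : (D.Gc Y)ᵀ = D.Gc Y := by
    simp [Gc, Matrix.transpose_mul, (isSymm_inv_Rc hRc).eq, Matrix.mul_assoc]
  rw [Matrix.transpose_sub, Matrix.transpose_mul, hG, hX.eq, frozenRiccati, frozenRiccati]
  noncomm_ring

theorem posSemidef_mul_Gc_mul {P : Matrix (Fin n) (Fin n) ℝ} (hP : P.IsSymm)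
    (hRc : (D.Rc Y).PosDef) : (P * D.Gc Y * P).PosSemidef := by
  have h := hRc.inv.posSemidef.mul_mul_conjTranspose_same (P * D.B)
  simpa [Gc, conjTranspose_eq_transpose_of_trivial, Matrix.transpose_mul, hP.eq,
    Matrix.mul_assoc] using h

/-- The deterministic running cost as a sum of two squares. -/
theorem running_cost_eq {p : ℕ} {C : Matrix (Fin p) (Fin n) ℝ} (hR : D.R.PosDef)
    (hC : Cᵀ * C = D.Q - D.L * D.R⁻¹ * D.Lᵀ) (x : Fin n → ℝ) (u : Fin m → ℝ) :
    x ⬝ᵥ D.Q *ᵥ x + 2 * (x ⬝ᵥ D.L *ᵥ u) + u ⬝ᵥ D.R *ᵥ u = (C *ᵥ x) ⬝ᵥ (C *ᵥ x)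
      + (u + D.R⁻¹ *ᵥ D.Lᵀ *ᵥ x) ⬝ᵥ D.R *ᵥ (u + D.R⁻¹ *ᵥ D.Lᵀ *ᵥ x) := by
  have hu : IsUnit D.R.det := (Matrix.isUnit_iff_isUnit_det _).1 hR.isUnit
  have hs := isSymm_of_posDef hR
  set w := D.R⁻¹ *ᵥ D.Lᵀ *ᵥ x with hw
  have hRw : D.R *ᵥ w = D.Lᵀ *ᵥ x := by
    rw [hw, Matrix.mulVec_mulVec, Matrix.mul_nonsing_inv _ hu, Matrix.one_mulVec]
  have h1 : ∀ y, y ⬝ᵥ D.R *ᵥ w = x ⬝ᵥ D.L *ᵥ y := by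
    intro y
    rw [hRw, dotProduct_mulVec, Matrix.vecMul_transpose, dotProduct_comm]
  have h2 : (C *ᵥ x) ⬝ᵥ (C *ᵥ x) = x ⬝ᵥ D.Q *ᵥ x - w ⬝ᵥ D.R *ᵥ w := by
    have e : (C *ᵥ x) ⬝ᵥ (C *ᵥ x) = x ⬝ᵥ (Cᵀ * C) *ᵥ x := by
      rw [← Matrix.mulVec_mulVec, dotProduct_mulVec x, Matrix.vecMul_transpose]
    rw [h1, e, hC,
      Matrix.sub_mulVec, dotProduct_sub, ← Matrix.mulVec_mulVec, ← Matrix.mulVec_mulVec]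
  have h3 := hs.mulVec_dotProduct_comm w u
  have h4 := h1 u
  simp only [Matrix.mulVec_add, dotProduct_add, add_dotProduct]
  linarith

/-- If `X ≥ 0` is a supersolution of the Riccati equation frozen at `Y ≥ 0`, then the associated
closed-loop matrix is stable. -/
theorem isStableMatrix_closedLoop {p : ℕ} {C : Matrix (Fin p) (Fin n) ℝ} (hR : D.R.PosDef)
    (hC : Cᵀ * C = D.Q - D.L * D.R⁻¹ * D.Lᵀ) (hdet : IsDetectablePair C D.A)
    (hker : ∀ x : Fin n → ℝ, C *ᵥ x = 0 → D.Lᵀ *ᵥ x = 0)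
    (hX : X.PosSemidef) (hY : Y.PosSemidef) (hric : (-D.frozenRiccati X Y).PosSemidef) :
    IsStableMatrix (D.Ac Y - D.Gc Y * X) := by
  intro z hz
  have hXs := (Matrix.posSemidef_iff_real.1 hX).1
  have hYs := (Matrix.posSemidef_iff_real.1 hY).1
  have hRp := (Matrix.posSemidef_iff_real.1 hR.posSemidef).2
  set M := D.Ac Y - D.Gc Y * X with hM
  set v : (Fin n → ℝ) → Fin m → ℝ :=
    fun x => -(D.gain X Y *ᵥ x) + D.R⁻¹ *ᵥ D.Lᵀ *ᵥ x with hv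
  have hMv : ∀ x, M *ᵥ x = D.A *ᵥ x + D.B *ᵥ -(D.gain X Y *ᵥ x) := by
    intro x
    rw [hM, Ac_sub_Gc_mul hXs, Matrix.sub_mulVec, ← Matrix.mulVec_mulVec, Matrix.mulVec_neg,
      sub_eq_add_neg]
  have hle : ∀ x, 2 * ((X *ᵥ x) ⬝ᵥ M *ᵥ x) + (C *ᵥ x) ⬝ᵥ (C *ᵥ x) + v x ⬝ᵥ D.R *ᵥ v x ≤ 0 := by
    intro x
    have h1 := (Matrix.posSemidef_iff_real.1 hric).2 x
    rw [Matrix.neg_mulVec, dotProduct_neg, ← cost_gain hXs (posDef_Rc hR hY),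
      cost_eq_add_sum hYs, ← hMv] at h1
    have h2 := running_cost_eq hR hC x (-(D.gain X Y *ᵥ x))
    have h3 : 0 ≤ ∑ i, (D.A0 i *ᵥ x + D.B0 i *ᵥ -(D.gain X Y *ᵥ x)) ⬝ᵥ
        Y *ᵥ (D.A0 i *ᵥ x + D.B0 i *ᵥ -(D.gain X Y *ᵥ x)) :=
      Finset.sum_nonneg fun i _ => (Matrix.posSemidef_iff_real.1 hY).2 _
    linarith
  obtain ⟨a, b, hab, ha, hb⟩ := (Matrix.mem_spectrum_map_iff M z).1 hz
  by_contra! hre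
  have hCC : ∀ x, 0 ≤ (C *ᵥ x) ⬝ᵥ (C *ᵥ x) := fun x =>
    Finset.sum_nonneg fun i _ => mul_self_nonneg _
  -- The terms in the imaginary part of z cancel, leaving z.re (aᵀXa + bᵀXb). Added to `hle a` and
  -- `hle b`, this forces every square there to vanish.
  have hsum : 0 ≤ (X *ᵥ a) ⬝ᵥ M *ᵥ a + (X *ᵥ b) ⬝ᵥ M *ᵥ b := by
    have h1 := (Matrix.posSemidef_iff_real.1 hX).2 a
    have h2 := (Matrix.posSemidef_iff_real.1 hX).2 b
    have h3 := hXs.mulVec_dotProduct_comm a b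
    rw [ha, hb, dotProduct_comm _ (_ - _), dotProduct_comm _ (_ + _)]
    simp only [sub_dotProduct, add_dotProduct, smul_dotProduct, smul_eq_mul]
    rw [h3]
    nlinarith [mul_nonneg hre h1, mul_nonneg hre h2]
  -- Cx = 0 kills Lᵀx, so v x = 0 says that the feedback itself vanishes at x.
  have key : ∀ x, (C *ᵥ x) ⬝ᵥ (C *ᵥ x) = 0 → v x ⬝ᵥ D.R *ᵥ v x = 0 →
      M *ᵥ x = D.A *ᵥ x ∧ C *ᵥ x = 0 := by
    intro x h1 h2
    have h3 : C *ᵥ x = 0 := dotProduct_self_eq_zero.1 h1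
    have h4 : v x = 0 := by
      by_contra h0
      have := hR.dotProduct_mulVec_pos h0
      rw [star_trivial, h2] at this
      exact lt_irrefl _ this
    rw [hv] at h4
    simp only [hker x h3, Matrix.mulVec_zero, add_zero] at h4
    refine ⟨?_, h3⟩
    rw [hMv, h4, Matrix.mulVec_zero, add_zero]
  have ea := hle a
  have eb := hle b
  have pa := hCC a
  have pb := hCC b
  have ra := hRp (v a)
  have rb := hRp (v b)
  obtain ⟨ha1, ha2⟩ := key a (by linarith) (by linarith)
  obtain ⟨hb1, hb2⟩ := key b (by linarith) (by linarith)
  obtain ⟨K, hK⟩ := hdet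
  -- This matrix agrees with M on a and b, so it would have the eigenvalue z with z.re ≥ 0.
  have hstable : IsStableMatrix (D.A + Kᵀ * C) := by
    intro w hw
    refine hK w ?_
    rw [Matrix.mem_spectrum_iff_isRoot_charpoly] at hw ⊢
    have : D.A + Kᵀ * C = (D.Aᵀ + Cᵀ * K)ᵀ := by
      simp [Matrix.transpose_add, Matrix.transpose_mul]
    rw [this, Matrix.transpose_map, Matrix.charpoly_transpose] at hw
    exact hw
  refine absurd (hstable z ((Matrix.mem_spectrum_map_iff _ z).2 ⟨a, b, hab, ?_, ?_⟩)) (not_lt.2 hre)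
  · rw [Matrix.add_mulVec, ← Matrix.mulVec_mulVec, ha2, Matrix.mulVec_zero, add_zero, ← ha1, ha]
  · rw [Matrix.add_mulVec, ← Matrix.mulVec_mulVec, hb2, Matrix.mulVec_zero, add_zero, ← hb1, hb]

end SCAREData

/-! ### Monotone convergence in the semidefinite order -/

namespace Matrix

variable {n : ℕ}

theorem isClosed_setOf_posSemidef :
    IsClosed {P : Matrix (Fin n) (Fin n) ℝ | P.PosSemidef} := by
  simp only [posSemidef_iff_real, Set.ofPred_and, Set.ofPred_forall]
  refine (isClosed_eq continuous_id.matrix_transpose continuous_id).inter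
    (isClosed_iInter fun x => isClosed_le continuous_const ?_)
  exact continuous_const.dotProduct (continuous_id.matrix_mulVec continuous_const)

theorem dotProduct_mulVec_mono {P P' : Matrix (Fin n) (Fin n) ℝ} (h : (P' - P).PosSemidef)
    (x : Fin n → ℝ) : x ⬝ᵥ P *ᵥ x ≤ x ⬝ᵥ P' *ᵥ x := by
  have := (posSemidef_iff_real.1 h).2 x
  rwa [sub_mulVec, dotProduct_sub, sub_nonneg] at this

/-- A monotone sequence of symmetric matrices that is bounded above converges. -/
theorem exists_tendsto_of_monotone_of_bounded {X : ℕ → Matrix (Fin n) (Fin n) ℝ}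
    {U : Matrix (Fin n) (Fin n) ℝ} (hs : ∀ k, (X k).IsSymm)
    (hmono : ∀ k, (X (k + 1) - X k).PosSemidef) (hU : ∀ k, (U - X k).PosSemidef) :
    ∃ Y, Tendsto X atTop (𝓝 Y) := by
  have hq : ∀ x : Fin n → ℝ, ∃ l, Tendsto (fun k => x ⬝ᵥ X k *ᵥ x) atTop (𝓝 l) := fun x =>
    ⟨_, tendsto_atTop_ciSup (monotone_nat_of_le_succ fun k => dotProduct_mulVec_mono (hmono k) x)
      ⟨x ⬝ᵥ U *ᵥ x, by rintro _ ⟨k, rfl⟩; exact dotProduct_mulVec_mono (hU k) x⟩⟩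
  choose q hq using hq
  -- Polarization recovers the entries from the limits of the quadratic forms.
  refine ⟨Matrix.of fun i j => (q (Pi.single i 1 + Pi.single j 1)
    - q (Pi.single i 1) - q (Pi.single j 1)) / 2, ?_⟩
  refine tendsto_pi_nhds.2 fun i => tendsto_pi_nhds.2 fun j => ?_
  refine ((((hq (Pi.single i 1 + Pi.single j 1)).sub (hq (Pi.single i 1))).sub
    (hq (Pi.single j 1))).div_const 2).congr fun k => ?_
  have h := (hs k).apply i j
  simp only [mulVec_add, dotProduct_add, add_dotProduct, mulVec_single_one, single_one_dotProduct,
    Matrix.col_apply]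
  rw [h]
  ring

end Matrix

/-! ### The iteration step and continuity of the coefficients -/

namespace SCAREData

variable {n m r : ℕ} {D : SCAREData n m r}

/-- One step of the iteration preserves the invariants. -/
theorem fpcare_step {X X' U : Matrix (Fin n) (Fin n) ℝ} (hR : D.R.PosDef) (hQ : D.Q.IsSymm)
    (hX : X.PosSemidef) (hU : U.PosSemidef) (hXU : (U - X).PosSemidef)
    (hUric : D.frozenRiccati U U = 0) (hric : (D.frozenRiccati X X).PosSemidef)
    (hstab : IsStableMatrix (D.Ac X - D.Gc X * U))
    (h : IsStabilizingCARESolution (D.Ac X) (D.Gc X) (D.Hc X) X') :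
    (X' - X).PosSemidef ∧ (U - X').PosSemidef ∧ X'.PosSemidef ∧
      (D.frozenRiccati X' X').PosSemidef := by
  have hXs := (Matrix.posSemidef_iff_real.1 hX).1
  have hUs := (Matrix.posSemidef_iff_real.1 hU).1
  have hRc := posDef_Rc hR hX
  have hRcs := isSymm_of_posDef hRc
  have h0 : D.frozenRiccati X' X = 0 := h.eqn
  have h1 : (X' - X).PosSemidef := by
    rw [← neg_sub]
    refine h.stable.posSemidef_neg_of_lyapunov (hXs.sub h.symm) ?_
    rw [frozenRiccati_sub h.symm hRcs, h0, sub_zero]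
    exact hric.add (posSemidef_mul_Gc_mul (hXs.sub h.symm) hRc)
  have h2 : (U - X').PosSemidef := by
    rw [← neg_sub]
    refine hstab.posSemidef_neg_of_lyapunov (h.symm.sub hUs) ?_
    rw [frozenRiccati_sub hUs hRcs, h0, ← hUric]
    exact (frozenRiccati_mono hR hQ hUs hX hU hXU).add
      (posSemidef_mul_Gc_mul (h.symm.sub hUs) hRc)
  have h3 : X'.PosSemidef := by simpa using h1.add hX
  refine ⟨h1, h2, h3, ?_⟩
  have := frozenRiccati_mono hR hQ h.symm hX h3 h1
  rwa [h0, sub_zero] at this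

theorem continuous_Rc : Continuous D.Rc := by
  unfold Rc Pi22; fun_prop

theorem continuous_Lc : Continuous D.Lc := by
  unfold Lc Pi12; fun_prop

theorem continuous_Qc : Continuous D.Qc := by
  unfold Qc Pi11; fun_prop

theorem continuousAt_inv_Rc {Y : Matrix (Fin n) (Fin n) ℝ} (hY : IsUnit (D.Rc Y).det) :
    ContinuousAt (fun Y => (D.Rc Y)⁻¹) Y := by
  refine ContinuousAt.comp (g := Inv.inv) (f := D.Rc) ?_ continuous_Rc.continuousAt
  refine continuousAt_matrix_inv _ ?_
  rw [Ring.inverse_eq_inv']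
  exact continuousAt_inv₀ hY.ne_zero

theorem continuousAt_Ac {Y : Matrix (Fin n) (Fin n) ℝ} (hY : IsUnit (D.Rc Y).det) :
    ContinuousAt D.Ac Y := by
  have h : Continuous fun P : Matrix (Fin n) (Fin n) ℝ × Matrix (Fin m) (Fin m) ℝ =>
      D.A - D.B * P.2 * (D.Lc P.1)ᵀ :=
    continuous_const.sub ((continuous_const.matrix_mul continuous_snd).matrix_mul
      (continuous_Lc.comp continuous_fst).matrix_transpose)
  exact h.continuousAt.comp (f := fun Y => (Y, (D.Rc Y)⁻¹))
    (continuousAt_id.prodMk (continuousAt_inv_Rc hY))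

theorem continuousAt_Gc {Y : Matrix (Fin n) (Fin n) ℝ} (hY : IsUnit (D.Rc Y).det) :
    ContinuousAt D.Gc Y :=
  (continuous_const.matrix_mul continuous_id).matrix_mul continuous_const |>.continuousAt.comp
    (continuousAt_inv_Rc hY)

theorem continuousAt_Hc {Y : Matrix (Fin n) (Fin n) ℝ} (hY : IsUnit (D.Rc Y).det) :
    ContinuousAt D.Hc Y := by
  have h : Continuous fun P : Matrix (Fin n) (Fin n) ℝ × Matrix (Fin m) (Fin m) ℝ =>
      D.Qc P.1 - D.Lc P.1 * P.2 * (D.Lc P.1)ᵀ :=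
    (continuous_Qc.comp continuous_fst).sub
      (((continuous_Lc.comp continuous_fst).matrix_mul continuous_snd).matrix_mul
        (continuous_Lc.comp continuous_fst).matrix_transpose)
  exact h.continuousAt.comp (f := fun Y => (Y, (D.Rc Y)⁻¹))
    (continuousAt_id.prodMk (continuousAt_inv_Rc hY))

end SCAREData

/-! ### Convergence of the iteration -/

theorem mainTheorem1 {n m r p : ℕ} (D : SCAREData n m r) (C : Matrix (Fin p) (Fin n) ℝ)
    (hR : D.R.PosDef)
    (hC : Cᵀ * C = D.Q - D.L * D.R⁻¹ * D.Lᵀ)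
    (hstab : IsStabilizablePair D.A D.B)
    (hdet : IsDetectablePair C D.A)
    (hker : ∀ x : Fin n → ℝ, C *ᵥ x = 0 → (∀ i, D.A0 i *ᵥ x = 0) ∧ D.Lᵀ *ᵥ x = 0)
    (Xhat : Matrix (Fin n) (Fin n) ℝ) (hXhat : Xhat.PosSemidef) (hsol : D.IsSolution Xhat)
    (X : ℕ → Matrix (Fin n) (Fin n) ℝ) (hX0 : X 0 = 0) (hX : D.IsFPCARESequence X) :
    (∀ k, (X (k + 1) - X k).PosSemidef ∧ (Xhat - X k).PosSemidef ∧
      (D.riccati (X k)).PosSemidef ∧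
      IsStableMatrix (D.Ac (X k) - D.Gc (X k) * Xhat)) ∧
    ∃ Xm : Matrix (Fin n) (Fin n) ℝ,
      Tendsto X atTop (𝓝 Xm) ∧ Xm.PosSemidef ∧ (Xhat - Xm).PosSemidef ∧ D.IsSolution Xm ∧
      spectrum ℂ ((D.Ac Xm - D.Gc Xm * Xm).map (algebraMap ℝ ℂ)) ⊆ {z : ℂ | z.re ≤ 0} := by
  have hUs := (Matrix.posSemidef_iff_real.1 hXhat).1
  have hRs := SCAREData.isSymm_of_posDef hR
  -- Symmetry of Q is not assumed; it comes from the factorization Q = CᵀC + LR⁻¹Lᵀ.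
  have hQ : D.Q.IsSymm := by
    have e : D.Q = Cᵀ * C + D.L * D.R⁻¹ * D.Lᵀ := by rw [hC, sub_add_cancel]
    have hRi : (D.R⁻¹)ᵀ = D.R⁻¹ := by rw [Matrix.transpose_nonsing_inv, hRs.eq]
    simp [e, Matrix.IsSymm, Matrix.transpose_mul, hRi, Matrix.mul_assoc]
  have hUric : D.frozenRiccati Xhat Xhat = 0 :=
    (SCAREData.isSolution_iff hUs
      (SCAREData.isSymm_of_posDef (SCAREData.posDef_Rc hR hXhat))).1 hsol
  have hcl : ∀ Y : Matrix (Fin n) (Fin n) ℝ, Y.PosSemidef → (Xhat - Y).PosSemidef →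
      IsStableMatrix (D.Ac Y - D.Gc Y * Xhat) := by
    intro Y hY hYU
    refine SCAREData.isStableMatrix_closedLoop hR hC hdet (fun x hx => (hker x hx).2) hXhat hY ?_
    have := SCAREData.frozenRiccati_mono hR hQ hUs hY hXhat hYU
    rwa [hUric, zero_sub] at this
  have hinv : ∀ k, (X k).PosSemidef ∧ (Xhat - X k).PosSemidef ∧
      (D.frozenRiccati (X k) (X k)).PosSemidef := by
    intro k
    induction k with
    | zero =>
      rw [hX0]
      refine ⟨Matrix.PosSemidef.zero, by simpa using hXhat, ?_⟩
      have e : D.frozenRiccati 0 0 = Cᵀ * C := by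
        simp [hC, SCAREData.frozenRiccati, SCAREData.Hc, SCAREData.Qc, SCAREData.Lc,
          SCAREData.Rc, SCAREData.Pi11, SCAREData.Pi12, SCAREData.Pi22]
      rw [e, ← conjTranspose_eq_transpose_of_trivial]
      exact Matrix.posSemidef_conjTranspose_mul_self C
    | succ k ih =>
      obtain ⟨h1, h2, h3⟩ := ih
      obtain ⟨-, h4, h5, h6⟩ :=
        SCAREData.fpcare_step hR hQ h1 hXhat h2 hUric h3 (hcl _ h1 h2) (hX k)
      exact ⟨h5, h4, h6⟩
  have hmono : ∀ k, (X (k + 1) - X k).PosSemidef := fun k =>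
    (SCAREData.fpcare_step hR hQ (hinv k).1 hXhat (hinv k).2.1 hUric (hinv k).2.2
      (hcl _ (hinv k).1 (hinv k).2.1) (hX k)).1
  refine ⟨fun k => ⟨hmono k, (hinv k).2.1, (hinv k).2.2, hcl _ (hinv k).1 (hinv k).2.1⟩, ?_⟩
  obtain ⟨Xm, hlim⟩ := Matrix.exists_tendsto_of_monotone_of_bounded
    (fun k => (Matrix.posSemidef_iff_real.1 (hinv k).1).1) hmono fun k => (hinv k).2.1
  have hXm : Xm.PosSemidef :=
    Matrix.isClosed_setOf_posSemidef.mem_of_tendsto hlim (Eventually.of_forall fun k => (hinv k).1)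
  have hXmU : (Xhat - Xm).PosSemidef :=
    Matrix.isClosed_setOf_posSemidef.mem_of_tendsto (tendsto_const_nhds.sub hlim)
      (Eventually.of_forall fun k => (hinv k).2.1)
  have hRc := SCAREData.posDef_Rc hR hXm
  have hu : IsUnit (D.Rc Xm).det := (Matrix.isUnit_iff_isUnit_det _).1 hRc.isUnit
  have hlim1 := hlim.comp (tendsto_add_atTop_nat 1)
  have hA := (SCAREData.continuousAt_Ac hu).tendsto.comp hlim
  have hG := (SCAREData.continuousAt_Gc hu).tendsto.comp hlim
  have hH := (SCAREData.continuousAt_Hc hu).tendsto.comp hlim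
  refine ⟨Xm, hlim, hXm, hXmU, ?_, fun z hz => ?_⟩
  · rw [SCAREData.isSolution_iff (Matrix.posSemidef_iff_real.1 hXm).1
      (SCAREData.isSymm_of_posDef hRc)]
    have htr : Tendsto (fun k => (D.Ac (X k))ᵀ) atTop (𝓝 (D.Ac Xm)ᵀ) :=
      (continuous_id.matrix_transpose.tendsto _).comp hA
    refine tendsto_nhds_unique ((((htr.mul hlim1).add (hlim1.mul hA)).sub
      ((hlim1.mul hG).mul hlim1)).add hH) (tendsto_const_nhds.congr fun k => ?_)
    exact (hX k).eqn.symm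
  · have hcont : Continuous fun N : Matrix (Fin n) (Fin n) ℝ => N.map (algebraMap ℝ ℂ) :=
      continuous_id.matrix_map Complex.continuous_ofReal
    -- The matrices A_k - G_k X_{k+1} are stable and converge to the closed-loop matrix at the
    -- limit; strictness may be lost.
    exact Matrix.re_nonpos_of_mem_spectrum_of_tendsto
      ((hcont.tendsto _).comp (hA.sub (hG.mul hlim1))) (fun k w hw => ((hX k).stable w hw).le) hz
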